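/- Let $q$ be odd, let $\chi$ be the quadratic character of $\mathbb{F}_q$, and let $n,k$ be integers with $1\le k<n$. An $[n,k]_q$ code is a $k$-dimensional subspace of $\mathbb{F}_q^n$ (row vectors). For a symmetric $M\in\mathbb{F}_q^{n\times n}$, a code $C$ is $M$-LCD if the only $y\in C$ with $xMy^T=0$ for all $x\in C$ is $y=0$; LCD means $I$-LCD. For an $M$-LCD code $C$ with generator matrix $G$ (rows forming a basis of $C$) put $\Pi_{C,M}=MG^T(GMG^T)^{-1}G$, which does not depend on the choice of $G$. Codes $C_1,C_2$ are permutation-equivalent, $C_1\cong C_2$, if $C_2=C_1P$ for some permutation matrix $P$; matrices satisfy $A_1\cong A_2$ if $A_2=P^TA_1P$ for some permutation matrix $P$. Let $J$ be the all-ones matrix. A code $C$ is GI-reducible if there are $a,b\in\mathbb{F}_q$ such that $M=aI+bJ$ is invertible, every code in the permutation class of $C$ is $M$-LCD, and $C_1\cong C_2\iff\Pi_{C_1,M}\cong\Pi_{C_2,M}$ holds for all $C_1,C_2$ in that class. Let $L(n,k,q)$ be the number of LCD $[n,k]_q$ codes, and let $K(n,q)=|\{x\in\mathbb{F}_q^n:\sum_i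 x_i^2=0,\ \sum_i x_i\ne0\}|$. Fix a non-square $\gamma\in\mathbb{F}_q^*$; let $M^{+1}=I$ and $M^{-1}=\mathrm{diag}(1,\dots,1,\gamma)$ in each size (both the empty matrix in size $0$), and for $\epsilon\in\{+1,-1\}$ let $L^\epsilon(m,j,q)$ be the number of $j$-dimensional $M^\epsilon$-LCD subspaces of $\mathbb{F}_q^m$. **Theorem.** The number of GI-reducible $[n,k]_q$ codes is $$L(n,k,q)+\frac{K(n,q)}{q-1}\cdot L^{\chi(-1)}(n-2,\,k-1,\,q).$$ Here $\chi(-1)=+1$ if $q\equiv1\pmod 4$ and $\chi(-1)=-1$ if $q\equiv3\pmod 4$. -/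

import Mathlib

namespace GICode

/-- The `M`-dual of a code `C`: all `y` with `x M yᵀ = 0` for every `x ∈ C`. -/
def dual {F : Type*} [Field F] {n : ℕ} (M : Matrix (Fin n) (Fin n) F)
    (C : Submodule F (Fin n → F)) : Submodule F (Fin n → F) where
  carrier := {y | ∀ x ∈ C, x ⬝ᵥ Matrix.mulVec M y = 0}
  zero_mem' := by
    intro x _
    simp
  add_mem' := by
    intro y z hy hz x hx
    rw [Matrix.mulVec_add, dotProduct_add, hy x hx, hz x hx, add_zero]
  smul_mem' := by
    intro c y hy x hx
    rw [Matrix.mulVec_smul, dotProduct_smul, hy x hx, smul_zero]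

/-- The `M`-hull of a code. For `M = 1` this is the hull for the standard inner product. -/
def hull {F : Type*} [Field F] {n : ℕ} (M : Matrix (Fin n) (Fin n) F)
    (C : Submodule F (Fin n → F)) : Submodule F (Fin n → F) :=
  C ⊓ dual M C

/-- `C` is `M`-LCD: its `M`-hull is zero. For `M = 1` these are the usual LCD codes. -/
def IsLCD {F : Type*} [Field F] {n : ℕ} (M : Matrix (Fin n) (Fin n) F)
    (C : Submodule F (Fin n → F)) : Prop :=
  hull M C = ⊥

/-- Permutation equivalence of codes: `C₂ = C₁ P` for a permutation matrix `P`
(acting on row vectors by `x ↦ x P`). -/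
def PermEquiv {F : Type*} [Field F] {n : ℕ} (C₁ C₂ : Submodule F (Fin n → F)) : Prop :=
  ∃ π : Equiv.Perm (Fin n), C₂ = C₁.map (Matrix.vecMulLinear (π.permMatrix F))

/-- Isomorphism of directed graphs with loops and edge weights in `F`, given by adjacency
matrices: `A₂ = Pᵀ A₁ P` for a permutation matrix `P`. -/
def GraphIso {F : Type*} [Field F] {n : ℕ} (A₁ A₂ : Matrix (Fin n) (Fin n) F) : Prop :=
  ∃ π : Equiv.Perm (Fin n), A₂ = (π.permMatrix F).transpose * A₁ * π.permMatrix F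

/-- `G` is a generator matrix of `C`: its rows form a basis of `C`. -/
def IsGeneratorMatrix {F : Type*} [Field F] {n k : ℕ} (G : Matrix (Fin k) (Fin n) F)
    (C : Submodule F (Fin n → F)) : Prop :=
  LinearIndependent F G.row ∧ Submodule.span F (Set.range G.row) = C

/-- A generator matrix of `C`, chosen once and for all. -/
noncomputable def genMatrix {F : Type*} [Field F] {n : ℕ} (C : Submodule F (Fin n → F)) :
    Matrix (Fin (Module.finrank F C)) (Fin n) F :=
  Matrix.of fun i => (Module.finBasis F C i : Fin n → F)

/-- The orthogonal projector `Π_{C,M} = M Gᵀ (G M Gᵀ)⁻¹ G` for a generator matrix `G` of `C`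
(meaningful when `C` is `M`-LCD). It does not depend on `G`: see `projector_eq`. -/
noncomputable def projector {F : Type*} [Field F] {n : ℕ} (M : Matrix (Fin n) (Fin n) F)
    (C : Submodule F (Fin n → F)) : Matrix (Fin n) (Fin n) F :=
  M * (genMatrix C).transpose * (genMatrix C * M * (genMatrix C).transpose)⁻¹ * genMatrix C

theorem isGeneratorMatrix_genMatrix {F : Type*} [Field F] {n : ℕ}
    (C : Submodule F (Fin n → F)) : IsGeneratorMatrix (genMatrix C) C := by
  have h : (genMatrix C).row = fun i => C.subtype (Module.finBasis F C i) := rfl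
  refine ⟨?_, ?_⟩
  · rw [h]
    exact (Module.finBasis F C).linearIndependent.map' C.subtype C.ker_subtype
  · rw [h]
    have := congrArg (Submodule.map C.subtype) (Module.finBasis F C).span_eq
    rw [Submodule.map_span, ← Set.range_comp] at this
    rw [Submodule.map_top, Submodule.range_subtype] at this
    exact this

/-- The projector can be computed from any generator matrix of the code. -/
theorem projector_eq {F : Type*} [Field F] {n k : ℕ} (M : Matrix (Fin n) (Fin n) F)
    (C : Submodule F (Fin n → F)) (G : Matrix (Fin k) (Fin n) F) (hG : IsGeneratorMatrix G C) :
    projector M C = M * G.transpose * (G * M * G.transpose)⁻¹ * G := by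
  have hk : k = Module.finrank F C := by
    have := finrank_span_eq_card hG.1
    rw [hG.2] at this
    simpa using this.symm
  subst hk
  have hmem : ∀ i, (genMatrix C).row i ∈ Submodule.span F (Set.range G.row) := by
    intro i
    rw [hG.2]
    exact (Module.finBasis F C i).2
  choose A hA using fun i => (Submodule.mem_span_range_iff_exists_fun F).1 (hmem i)
  have hAG : genMatrix C = Matrix.of A * G := by
    ext i j
    have := congrFun (hA i) j
    simp only [Finset.sum_apply, Pi.smul_apply, smul_eq_mul, Matrix.row] at this
    rw [← this]
    simp [Matrix.mul_apply]
  have hdet : IsUnit (Matrix.of A) := by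
    rw [← Matrix.linearIndependent_rows_iff_isUnit]
    have h1 := (isGeneratorMatrix_genMatrix C).1
    have h2 : (genMatrix C).row
        = fun i => Matrix.vecMulLinear G ((Matrix.of A).row i) := by
      funext i
      rw [hAG]
      rfl
    rw [h2] at h1
    exact LinearIndependent.of_comp (Matrix.vecMulLinear G) h1
  have hd := (Matrix.isUnit_iff_isUnit_det _).1 hdet
  unfold projector
  rw [hAG]
  generalize Matrix.of A = B at hd
  have hdt : IsUnit B.transpose.det := by rwa [Matrix.det_transpose]
  have e : B * G * M * (B * G).transpose = B * (G * M * G.transpose) * B.transpose := by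
    simp only [Matrix.transpose_mul, Matrix.mul_assoc]
  rw [e, Matrix.mul_inv_rev, Matrix.mul_inv_rev, Matrix.transpose_mul]
  calc M * (G.transpose * B.transpose)
        * (B.transpose⁻¹ * ((G * M * G.transpose)⁻¹ * B⁻¹)) * (B * G)
      = M * G.transpose * (B.transpose * B.transpose⁻¹) * (G * M * G.transpose)⁻¹
          * (B⁻¹ * B) * G := by simp only [Matrix.mul_assoc]
    _ = _ := by
        rw [Matrix.mul_nonsing_inv _ hdt, Matrix.nonsing_inv_mul _ hd, Matrix.mul_one,
          Matrix.mul_one]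

/-- The matrix `a I + b J`, where `J` is the all-ones matrix. -/
def structureMatrix {F : Type*} [Field F] (n : ℕ) (a b : F) : Matrix (Fin n) (Fin n) F :=
  a • (1 : Matrix (Fin n) (Fin n) F) + b • (Matrix.of fun _ _ => (1 : F))

/-- `C` is GI-reducible (via orthogonal projectors): for some nondegenerate `M = a I + b J`,
every code in the permutation class of `C` is `M`-LCD, and two codes of that class are
permutation equivalent if and only if their projectors are isomorphic graphs. -/
def IsGIReducible {F : Type*} [Field F] {n : ℕ} (C : Submodule F (Fin n → F)) : Prop :=
  ∃ a b : F, (structureMatrix n a b).det ≠ 0 ∧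
    (∀ C₁, PermEquiv C C₁ → IsLCD (structureMatrix n a b) C₁) ∧
    ∀ C₁ C₂, PermEquiv C C₁ → PermEquiv C C₂ →
      (PermEquiv C₁ C₂ ↔
        GraphIso (projector (structureMatrix n a b) C₁) (projector (structureMatrix n a b) C₂))

/-- The number of GI-reducible `[n,k]` codes over `F`. -/
noncomputable def giReducibleCount (F : Type*) [Field F] (n k : ℕ) : ℕ :=
  Set.ncard {C : Submodule F (Fin n → F) | Module.finrank F C = k ∧ IsGIReducible C}

/-- The number of `k`-dimensional `M`-LCD subspaces of `F ^ n`. -/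
noncomputable def lcdCountFor {F : Type*} [Field F] {n : ℕ} (M : Matrix (Fin n) (Fin n) F)
    (k : ℕ) : ℕ :=
  Set.ncard {C : Submodule F (Fin n → F) | Module.finrank F C = k ∧ IsLCD M C}

/-- `L(n,k,q)`: the number of `[n,k]` LCD codes over `F` for the standard inner product. -/
noncomputable def lcdCount (F : Type*) [Field F] (n k : ℕ) : ℕ :=
  lcdCountFor (1 : Matrix (Fin n) (Fin n) F) k

/-- `M^ε`, for `ε = 1` or `ε = -1`, relative to a non-square `γ`: the identity matrix for
`ε = 1`, and `diag(1, …, 1, γ)` for `ε = -1`. -/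
def typeMatrix {F : Type*} [Field F] (γ : F) (ε : ℤ) (n : ℕ) : Matrix (Fin n) (Fin n) F :=
  Matrix.diagonal fun i => if ε = -1 ∧ (i : ℕ) + 1 = n then γ else 1

/-- `L^ε(n,k,q)`: the number of `k`-dimensional subspaces of `F ^ n` that are LCD for `M^ε`. -/
noncomputable def lcdCountType {F : Type*} [Field F] (γ : F) (ε : ℤ) (n k : ℕ) : ℕ :=
  lcdCountFor (typeMatrix γ ε n) k

/-- `K(n,q)`: the number of isotropic vectors of `F ^ n` with nonzero coordinate sum. -/
noncomputable def isotropicCount (F : Type*) [Field F] (n : ℕ) : ℕ :=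
  Set.ncard {x : Fin n → F | x ⬝ᵥ x = 0 ∧ ∑ i, x i ≠ 0}

end GICode

namespace GICode

open Matrix

/-! Permutation matrices fix every `M = aI + bJ` under conjugation, so permuting a code conjugates
its projector; conversely the row space of the projector is the code. Hence GI-reducible means
`M`-LCD for a single invertible `M = aI + bJ` (`isGIReducible_iff`). The form of `M` is `a (x·y) + b
s(x) s(y)`, with `s` the coordinate sum. Hull vectors with `s = 0` are `M`-orthogonal to the whole
code, so `s` must be injective on the hull: the hull is zero or a line `⟨u⟩` with `s(u) ≠ 0`. Both
cases do occur for a suitable `M` (`isGIReducible_iff_hull`), and the first contributes `L(n,k,q)`.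
For the second, `u` is isotropic and is completed to a hyperbolic pair `u, v`. Codes with hull `⟨u⟩`
lie in `u^⊥ = ⟨u⟩ ⊕ {u,v}^⊥` and correspond to the LCD subspaces of dimension `k - 1` of `{u,v}^⊥`.
That space is nondegenerate of dimension `n - 2` and discriminant `-1` up to squares, hence of type
`χ(-1)` (`ncard_hull_eq_span_singleton`). Each such line has `q - 1` generators, which accounts for
the division. -/

/-! ### Projectors and permutation equivalence -/

theorem isLCD_iff {F : Type*} [Field F] {n : ℕ} {M : Matrix (Fin n) (Fin n) F}
    {C : Submodule F (Fin n → F)} :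
    IsLCD M C ↔ ∀ y ∈ C, (∀ x ∈ C, x ⬝ᵥ M *ᵥ y = 0) → y = 0 := by
  rw [IsLCD, Submodule.eq_bot_iff]
  exact ⟨fun h y hy hx => h y ⟨hy, hx⟩, fun h y hy => h y hy.1 hy.2⟩

theorem permMatrix_mul_transpose {F : Type*} [Field F] {n : ℕ} (π : Equiv.Perm (Fin n)) :
    π.permMatrix F * (π.permMatrix F)ᵀ = 1 := by
  rw [Matrix.transpose_permMatrix, ← Matrix.permMatrix_mul]
  simp

theorem permMatrix_conj_structureMatrix {F : Type*} [Field F] {n : ℕ}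
    (π : Equiv.Perm (Fin n)) (a b : F) :
    π.permMatrix F * structureMatrix n a b * (π.permMatrix F)ᵀ = structureMatrix n a b := by
  rw [Matrix.transpose_permMatrix, Equiv.Perm.permMatrix, Equiv.Perm.permMatrix,
    PEquiv.toMatrix_toPEquiv_mul, PEquiv.mul_toMatrix_toPEquiv]
  ext i j
  have h : (Equiv.symm π⁻¹) j = π j := rfl
  simp [structureMatrix, Matrix.one_apply, h]

theorem dotProduct_mulVec_vecMul {F : Type*} [Field F] {l n : ℕ} (P : Matrix (Fin l) (Fin n) F)
    (M : Matrix (Fin n) (Fin n) F) (x y : Fin l → F) :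
    (x ᵥ* P) ⬝ᵥ M *ᵥ (y ᵥ* P) = x ⬝ᵥ (P * M * Pᵀ) *ᵥ y := by
  rw [← Matrix.mulVec_transpose P y, Matrix.mulVec_mulVec, ← Matrix.dotProduct_mulVec,
    Matrix.mulVec_mulVec, Matrix.mul_assoc]

theorem IsLCD.map_vecMul {F : Type*} [Field F] {n : ℕ} {M P : Matrix (Fin n) (Fin n) F}
    {C : Submodule F (Fin n → F)} (hP : P * M * Pᵀ = M) (h : IsLCD M C) :
    IsLCD M (C.map P.vecMulLinear) := by
  rw [isLCD_iff] at h ⊢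
  rintro _ ⟨y, hy, rfl⟩ hx
  have := h y hy fun x hxC => by
    have := hx _ ⟨x, hxC, rfl⟩
    simp only [Matrix.vecMulLinear_apply] at this
    rwa [dotProduct_mulVec_vecMul, hP] at this
  rw [this, map_zero]

theorem isUnit_det_gram {F : Type*} [Field F] {n k : ℕ} {M : Matrix (Fin n) (Fin n) F}
    {C : Submodule F (Fin n → F)} {G : Matrix (Fin k) (Fin n) F}
    (hG : IsGeneratorMatrix G C) (h : IsLCD M C) : IsUnit (G * M * Gᵀ).det := by
  rw [isUnit_iff_ne_zero]
  intro h0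
  obtain ⟨v, hv, hv0⟩ := Matrix.exists_mulVec_eq_zero_iff.2 h0
  have hC : C = LinearMap.range G.vecMulLinear := by rw [range_vecMulLinear, hG.2]
  have := isLCD_iff.1 h (v ᵥ* G) (by rw [hC]; exact ⟨v, rfl⟩) fun x hx => by
    rw [hC] at hx
    obtain ⟨w, rfl⟩ := hx
    rw [Matrix.vecMulLinear_apply, dotProduct_mulVec_vecMul, hv0, dotProduct_zero]
  apply hv
  have hinj := Matrix.vecMul_injective_iff.2 hG.1
  exact hinj (by simpa using this)

/-- This recovers a code from its projector, so isomorphic projectors force equivalent codes. -/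
theorem range_projector {F : Type*} [Field F] {n : ℕ} {M : Matrix (Fin n) (Fin n) F}
    {C : Submodule F (Fin n → F)} (h : IsLCD M C) :
    LinearMap.range (projector M C).vecMulLinear = C := by
  have hG := isGeneratorMatrix_genMatrix C
  have hC : C = LinearMap.range (genMatrix C).vecMulLinear := by
    rw [range_vecMulLinear, hG.2]
  have hd := isUnit_det_gram hG h
  -- The projector fixes every codeword.
  have hP : genMatrix C * projector M C = genMatrix C := by
    rw [projector]
    simp only [← Matrix.mul_assoc]
    rw [Matrix.mul_nonsing_inv _ hd, Matrix.one_mul]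
  apply le_antisymm
  · rintro _ ⟨x, rfl⟩
    refine hC.ge ⟨x ᵥ* (M * (genMatrix C)ᵀ * (genMatrix C * M * (genMatrix C)ᵀ)⁻¹), ?_⟩
    simp [projector, Matrix.vecMul_vecMul]
  · refine hC.le.trans ?_
    rintro _ ⟨x, rfl⟩
    exact ⟨x ᵥ* genMatrix C, by simp [Matrix.vecMul_vecMul, hP]⟩

theorem projector_map_vecMul {F : Type*} [Field F] {n : ℕ} {M P : Matrix (Fin n) (Fin n) F}
    (C : Submodule F (Fin n → F)) (hP : P * Pᵀ = 1) (hM : P * M * Pᵀ = M) :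
    projector M (C.map P.vecMulLinear) = Pᵀ * projector M C * P := by
  have hP' : Pᵀ * P = 1 := mul_eq_one_comm.1 hP
  have hG := isGeneratorMatrix_genMatrix C
  have hinj : Function.Injective P.vecMulLinear := fun x y hxy => by
    have := congrArg (fun z => z ᵥ* Pᵀ) hxy
    simpa [Matrix.vecMul_vecMul, hP] using this
  have hG' : IsGeneratorMatrix (genMatrix C * P) (C.map P.vecMulLinear) := by
    have hrow : (genMatrix C * P).row = P.vecMulLinear ∘ (genMatrix C).row := rfl
    refine ⟨?_, ?_⟩
    · rw [hrow]
      exact hG.1.map' _ (LinearMap.ker_eq_bot.2 hinj)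
    · rw [hrow, Set.range_comp, ← Submodule.map_span, hG.2]
  have hMP : M * Pᵀ = Pᵀ * M := by
    calc M * Pᵀ = (Pᵀ * P) * M * Pᵀ := by rw [hP', Matrix.one_mul]
      _ = Pᵀ * (P * M * Pᵀ) := by simp only [Matrix.mul_assoc]
      _ = Pᵀ * M := by rw [hM]
  have e : genMatrix C * P * M * (genMatrix C * P)ᵀ = genMatrix C * M * (genMatrix C)ᵀ := by
    conv_rhs => rw [← hM]
    simp only [Matrix.transpose_mul, Matrix.mul_assoc]
  rw [projector_eq M _ _ hG', e, projector, Matrix.transpose_mul, ← Matrix.mul_assoc M, hMP]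
  simp only [Matrix.mul_assoc]

theorem map_vecMul_range {F : Type*} [Field F] {n : ℕ} {A P : Matrix (Fin n) (Fin n) F}
    (hP : P * Pᵀ = 1) : LinearMap.range (Pᵀ * A * P).vecMulLinear =
      (LinearMap.range A.vecMulLinear).map P.vecMulLinear := by
  ext y
  constructor
  · rintro ⟨x, rfl⟩
    exact ⟨x ᵥ* Pᵀ ᵥ* A, ⟨x ᵥ* Pᵀ, rfl⟩, by simp [Matrix.vecMul_vecMul]⟩
  · rintro ⟨_, ⟨x, rfl⟩, rfl⟩
    refine ⟨x ᵥ* P, ?_⟩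
    simp only [Matrix.vecMulLinear_apply, Matrix.vecMul_vecMul, ← Matrix.mul_assoc, hP,
      Matrix.one_mul]

theorem PermEquiv.refl {F : Type*} [Field F] {n : ℕ} (C : Submodule F (Fin n → F)) :
    PermEquiv C C :=
  ⟨1, by ext x; simp⟩

theorem isGIReducible_iff {F : Type*} [Field F] {n : ℕ} {C : Submodule F (Fin n → F)} :
    IsGIReducible C ↔
      ∃ a b : F, (structureMatrix n a b).det ≠ 0 ∧ IsLCD (structureMatrix n a b) C := by
  constructor
  · rintro ⟨a, b, hd, h, -⟩
    exact ⟨a, b, hd, h C (PermEquiv.refl C)⟩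
  · rintro ⟨a, b, hd, h⟩
    have hl : ∀ C₁, PermEquiv C C₁ → IsLCD (structureMatrix n a b) C₁ := by
      rintro _ ⟨π, rfl⟩
      exact h.map_vecMul (permMatrix_conj_structureMatrix π a b)
    refine ⟨a, b, hd, hl, fun C₁ C₂ h₁ h₂ => ⟨?_, ?_⟩⟩
    · rintro ⟨π, rfl⟩
      exact ⟨π, projector_map_vecMul _ (permMatrix_mul_transpose π)
        (permMatrix_conj_structureMatrix π a b)⟩
    · rintro ⟨π, hπ⟩
      refine ⟨π, ?_⟩
      rw [← range_projector (hl _ h₂), hπ, map_vecMul_range (permMatrix_mul_transpose π),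
        range_projector (hl _ h₁)]

/-! ### The forms `aI + bJ` and the hull criterion -/

theorem structureMatrix_mulVec {F : Type*} [Field F] {n : ℕ} (a b : F) (y : Fin n → F) :
    structureMatrix n a b *ᵥ y = a • y + fun _ => b * ∑ i, y i := by
  ext i
  rw [structureMatrix, Matrix.add_mulVec, Matrix.smul_mulVec, Matrix.smul_mulVec, Matrix.one_mulVec]
  simp [Matrix.mulVec, dotProduct]

theorem dotProduct_structureMatrix_mulVec {F : Type*} [Field F] {n : ℕ} (a b : F)
    (x y : Fin n → F) :
    x ⬝ᵥ structureMatrix n a b *ᵥ y = a * (x ⬝ᵥ y) + b * ((∑ i, x i) * ∑ i, y i) := by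
  rw [structureMatrix_mulVec, dotProduct_add, dotProduct_smul, smul_eq_mul]
  congr 1
  simp only [dotProduct]
  rw [← Finset.sum_mul]
  ring

theorem structureMatrix_one_det_ne_zero {F : Type*} [Field F] {n : ℕ} {c : F}
    (hc : 1 + c * n ≠ 0) : (structureMatrix n 1 c).det ≠ 0 := by
  intro h0
  obtain ⟨v, hv, hv0⟩ := Matrix.exists_mulVec_eq_zero_iff.2 h0
  rw [structureMatrix_mulVec, one_smul] at hv0
  have hs : (1 + c * n) * ∑ i, v i = 0 := by
    have := congrArg (fun w : Fin n → F => ∑ i, w i) hv0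
    simp only [Pi.add_apply, Finset.sum_add_distrib, Finset.sum_const, Finset.card_univ,
      Fintype.card_fin, nsmul_eq_mul, Pi.zero_apply] at this
    linear_combination this
  have hs0 := (mul_eq_zero.1 hs).resolve_left hc
  apply hv
  ext i
  have := congrFun hv0 i
  simpa [hs0] using this

theorem coeff_ne_zero_of_structureMatrix_det_ne_zero {F : Type*} [Field F] {n : ℕ} (hn : 2 ≤ n)
    {a b : F} (h : (structureMatrix n a b).det ≠ 0) : a ≠ 0 := by
  rintro rfl
  apply h
  refine Matrix.det_zero_of_row_eq (i := ⟨0, by omega⟩) (j := ⟨1, by omega⟩) (by simp) ?_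
  ext j
  simp [structureMatrix]

theorem mem_hull_one_iff {F : Type*} [Field F] {n : ℕ} {C : Submodule F (Fin n → F)}
    {y : Fin n → F} : y ∈ hull 1 C ↔ y ∈ C ∧ ∀ x ∈ C, x ⬝ᵥ y = 0 := by
  change (y ∈ C ∧ ∀ x ∈ C, x ⬝ᵥ 1 *ᵥ y = 0) ↔ _
  simp only [Matrix.one_mulVec]

/-- A code is GI-reducible if and only if it is LCD, or its hull is a line whose vectors have
nonzero coordinate sum. -/
theorem isGIReducible_iff_hull {F : Type*} [Field F] (h2 : (2 : F) ≠ 0) {n : ℕ} (hn : 2 ≤ n)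
    {C : Submodule F (Fin n → F)} :
    IsGIReducible C ↔ IsLCD 1 C ∨ ∃ u, ∑ i, u i ≠ 0 ∧ hull 1 C = Submodule.span F {u} := by
  rw [isGIReducible_iff]
  constructor
  · rintro ⟨a, b, hd, h⟩
    have ha := coeff_ne_zero_of_structureMatrix_det_ne_zero hn hd
    rw [isLCD_iff] at h
    have key : ∀ y ∈ hull 1 C, ∑ i, y i = 0 → y = 0 := fun y hy hs => by
      rw [mem_hull_one_iff] at hy
      refine h y hy.1 fun x hx => ?_
      rw [dotProduct_structureMatrix_mulVec, hy.2 x hx, hs]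
      ring
    by_cases hl : IsLCD 1 C
    · exact Or.inl hl
    · right
      obtain ⟨u, hu, hu0⟩ := Submodule.exists_mem_ne_zero_of_ne_bot hl
      have hs : ∑ i, u i ≠ 0 := fun hs => hu0 (key u hu hs)
      refine ⟨u, hs, le_antisymm (fun y hy => ?_) ?_⟩
      · rw [Submodule.mem_span_singleton]
        -- With this scalar `y` minus the multiple of `u` is a hull vector of coordinate sum zero,
        -- hence zero.
        refine ⟨(∑ i, y i) / ∑ i, u i, ?_⟩
        refine (sub_eq_zero.1 (key (y - _) (Submodule.sub_mem _ hy
          (Submodule.smul_mem _ _ hu)) ?_)).symm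
        simp only [Pi.sub_apply, Pi.smul_apply, smul_eq_mul, Finset.sum_sub_distrib,
          ← Finset.mul_sum]
        field_simp
        ring
      · rwa [Submodule.span_singleton_le_iff_mem]
  · rintro (h | ⟨u, hs, hu⟩)
    · refine ⟨1, 0, structureMatrix_one_det_ne_zero (by simp), ?_⟩
      simpa [structureMatrix] using h
    -- If `1 + n = 0` in `F`, then `1 - n = 2 ≠ 0`, so `c = -1` works.
    · obtain ⟨c, hc0, hc⟩ : ∃ c : F, c ≠ 0 ∧ 1 + c * n ≠ 0 := by
        by_cases h1 : (1 : F) + 1 * n = 0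
        · refine ⟨-1, by simp, fun h => h2 ?_⟩
          linear_combination h1 + h
        · exact ⟨1, one_ne_zero, h1⟩
      refine ⟨1, c, structureMatrix_one_det_ne_zero hc, isLCD_iff.2 fun y hy hx => ?_⟩
      have huh : u ∈ hull 1 C := by rw [hu]; exact Submodule.mem_span_singleton_self u
      rw [mem_hull_one_iff] at huh
      -- Testing `y` against `u` leaves only `c s(u) s(y) = 0`, because `u` is in the hull.
      have hys : ∑ i, y i = 0 := by
        have := hx u huh.1
        rw [dotProduct_structureMatrix_mulVec, dotProduct_comm, huh.2 y hy] at this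
        simpa [hc0, hs] using this
      have hyh : y ∈ hull 1 C := mem_hull_one_iff.2 ⟨hy, fun x hxC => by
        have := hx x hxC
        rw [dotProduct_structureMatrix_mulVec, hys] at this
        simpa using this⟩
      rw [hu, Submodule.mem_span_singleton] at hyh
      obtain ⟨t, rfl⟩ := hyh
      simp only [Pi.smul_apply, smul_eq_mul, ← Finset.mul_sum] at hys
      rw [(mul_eq_zero.1 hys).resolve_right hs, zero_smul]

/-! ### Classification of symmetric forms over a finite field of odd order -/

theorem exists_mul_sq_add_mul_sq_eq_one {F : Type*} [Field F] [Fintype F]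
    (hF : Fintype.card F % 2 = 1) {a b : F} (ha : a ≠ 0) (hb : b ≠ 0) :
    ∃ x y : F, a * x ^ 2 + b * y ^ 2 = 1 := by
  obtain ⟨x, y, h⟩ := FiniteField.exists_root_sum_quadratic
    (Polynomial.degree_quadratic (b := 0) (c := -1) ha)
    (Polynomial.degree_quadratic (b := 0) (c := 0) hb) hF
  refine ⟨x, y, ?_⟩
  simp at h
  linear_combination h

/-- Two vectors of an orthogonal basis span a nondegenerate binary form, which represents 1. -/
theorem exists_self_eq_one {F : Type*} [Field F] [Fintype F] (hF : Fintype.card F % 2 = 1)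
    (h2 : (2 : F) ≠ 0) {V : Type*} [AddCommGroup V] [Module F V] [FiniteDimensional F V]
    {B : LinearMap.BilinForm F V} (hs : B.IsSymm) (hB : B.Nondegenerate)
    (hV : 2 ≤ Module.finrank F V) : ∃ x, B x x = 1 := by
  have := invertibleOfNonzero h2
  obtain ⟨v, hv⟩ := LinearMap.BilinForm.exists_orthogonal_basis
        (LinearMap.BilinForm.isSymm_iff.1 hs)
  have hne := LinearMap.BilinForm.iIsOrtho.not_isOrtho_basis_self_of_nondegenerate hv hB
  let i : Fin (Module.finrank F V) := ⟨0, by omega⟩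
  let j : Fin (Module.finrank F V) := ⟨1, by omega⟩
  have hij : i ≠ j := by simp [i, j]
  obtain ⟨x, y, h⟩ := exists_mul_sq_add_mul_sq_eq_one hF (hne i) (hne j)
  have e1 : B (v i) (v j) = 0 := hv hij
  have e2 : B (v j) (v i) = 0 := hv hij.symm
  refine ⟨x • v i + y • v j, ?_⟩
  simp only [map_add, map_smul, LinearMap.add_apply, LinearMap.smul_apply, smul_eq_mul, e1, e2]
  linear_combination h

/-- A non-degenerate symmetric bilinear form over a finite field of odd order has a basis with
Gram matrix `diag(1, …, 1)` or `diag(1, …, 1, γ)`. -/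
theorem exists_gram_eq_typeMatrix {F : Type*} [Field F] [Fintype F]
    (hF : Fintype.card F % 2 = 1) (h2 : (2 : F) ≠ 0) {γ : F} (hγ : ¬ IsSquare γ) {V : Type*}
    [AddCommGroup V] [Module F V] [FiniteDimensional F V] {B : LinearMap.BilinForm F V}
    (hs : B.IsSymm) (hB : B.Nondegenerate) {m : ℕ} (hV : Module.finrank F V = m) :
    ∃ δ : ℤ, (δ = 1 ∨ δ = -1) ∧
      ∃ b : Fin m → V, ∀ i j, B (b i) (b j) = typeMatrix γ δ m i j := by
  induction m generalizing V with
  | zero => exact ⟨1, Or.inl rfl, Fin.elim0, fun i => i.elim0⟩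
  | succ m ih =>
    -- In dimension one the square class of the form decides the type; in higher dimension a vector
    -- of norm 1 splits off.
    rcases m with _ | m
    · have := invertibleOfNonzero h2
      obtain ⟨v, hv⟩ := LinearMap.BilinForm.exists_orthogonal_basis
        (LinearMap.BilinForm.isSymm_iff.1 hs)
      have hne := LinearMap.BilinForm.iIsOrtho.not_isOrtho_basis_self_of_nondegenerate hv hB
        ⟨0, by omega⟩
      generalize v ⟨0, by omega⟩ = w at hne
      by_cases hsq : IsSquare (B w w)
      · obtain ⟨c, hc⟩ := hsq
        have hc0 : c ≠ 0 := by
          rintro rfl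
          simp [hc] at hne
        refine ⟨1, Or.inl rfl, fun _ => c⁻¹ • w, fun i j => ?_⟩
        obtain rfl : i = j := Fin.ext (by omega)
        simp only [map_smul, LinearMap.smul_apply, smul_eq_mul, hc, typeMatrix,
          Matrix.diagonal_apply_eq]
        simp
        field_simp
      -- A product of two non-squares is a square; scaling `w` by `s / B w w` then gives norm `s² /
      -- B w w = γ`.
      · obtain ⟨s, hs'⟩ : IsSquare (γ * B w w) := by
          classical
          have hγ0 : γ ≠ 0 := by
            rintro rfl
            simp at hγ
          rw [← quadraticChar_one_iff_isSquare (mul_ne_zero hγ0 hne), map_mul,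
            quadraticChar_neg_one_iff_not_isSquare.2 hγ,
            quadraticChar_neg_one_iff_not_isSquare.2 hsq]
          rfl
        refine ⟨-1, Or.inr rfl, fun _ => (s / B w w) • w, fun i j => ?_⟩
        obtain rfl : i = j := Fin.ext (by omega)
        have hi : (i : ℕ) = 0 := by omega
        simp only [map_smul, LinearMap.smul_apply, smul_eq_mul, typeMatrix,
          Matrix.diagonal_apply_eq, hi]
        simp
        field_simp
        linear_combination -hs'
    · obtain ⟨x, hx⟩ := exists_self_eq_one hF h2 hs hB (by omega)
      have hx0 : B x x ≠ 0 := by rw [hx]; exact one_ne_zero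
      have hxne : x ≠ 0 := by
        rintro rfl
        simp at hx0
      have hfr := LinearMap.BilinForm.finrank_orthogonal hB (Submodule.span F {x})
      rw [finrank_span_singleton hxne, hV] at hfr
      obtain ⟨δ, hδ, b, hb⟩ := ih (hs.restrict _)
        (LinearMap.BilinForm.restrict_nondegenerate_orthogonal_spanSingleton B hB hs.isRefl hx0)
        hfr
      have hxb : ∀ i, B x (b i) = 0 := fun i =>
        (b i).2 x (Submodule.mem_span_singleton_self x)
      -- The new vector goes in front, so that a possible `γ` stays in the last place.
      refine ⟨δ, hδ, Fin.cons x fun i => (b i : V), fun i j => ?_⟩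
      refine Fin.cases ?_ (fun i => ?_) i <;> refine Fin.cases ?_ (fun j => ?_) j
      · simp [hx, typeMatrix]
      · rw [Fin.cons_zero, Fin.cons_succ, hxb, typeMatrix,
          Matrix.diagonal_apply_ne _ (Fin.succ_ne_zero j).symm]
      · rw [Fin.cons_zero, Fin.cons_succ, hs.eq, hxb, typeMatrix,
          Matrix.diagonal_apply_ne _ (Fin.succ_ne_zero i)]
      · refine (hb i j).trans ?_
        simp [typeMatrix, Matrix.diagonal_apply]

/-! ### Hyperbolic planes and their complements -/

theorem exists_hyperbolic_partner {F : Type*} [Field F] (h2 : (2 : F) ≠ 0) {n : ℕ}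
    {u : Fin n → F} (hu0 : u ≠ 0) (hu : u ⬝ᵥ u = 0) : ∃ v, u ⬝ᵥ v = 1 ∧ v ⬝ᵥ v = 0 := by
  obtain ⟨i, hi⟩ := Function.ne_iff.1 hu0
  have hi : u i ≠ 0 := hi
  obtain ⟨w, hw⟩ : ∃ w, u ⬝ᵥ w = 1 := ⟨Pi.single i (u i)⁻¹, by simp [hi]⟩
  -- Subtracting `t u` keeps the pairing with `u` and lowers `w·w` by `2t`.
  refine ⟨w - (w ⬝ᵥ w / 2) • u, ?_, ?_⟩
  · simp [hu, hw]
  · simp only [sub_dotProduct, dotProduct_sub, smul_dotProduct, dotProduct_smul, smul_eq_mul, hu,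
      dotProduct_comm w u, hw]
    field_simp
    ring

theorem typeMatrix_apply_self_ne_zero {F : Type*} [Field F] {γ : F} (hγ : ¬ IsSquare γ) (δ : ℤ)
    (m : ℕ) (i : Fin m) : typeMatrix γ δ m i i ≠ 0 := by
  have hγ0 : γ ≠ 0 := by
    rintro rfl
    simp at hγ
  rw [typeMatrix, Matrix.diagonal_apply_eq]
  split_ifs
  · exact hγ0
  · exact one_ne_zero

theorem det_typeMatrix_one {F : Type*} [Field F] (γ : F) (m : ℕ) :
    (typeMatrix γ 1 m).det = 1 := by
  rw [typeMatrix, Matrix.det_diagonal]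
  exact Finset.prod_eq_one fun i _ => by simp

theorem det_typeMatrix_neg_one {F : Type*} [Field F] (γ : F) (m : ℕ) :
    (typeMatrix γ (-1) (m + 1)).det = γ := by
  rw [typeMatrix, Matrix.det_diagonal, Fin.prod_univ_castSucc, Finset.prod_eq_one]
  · simp
  · intro i _
    have : ¬ ((i : ℕ) = m) := by omega
    simp [this]

/-- The rows `u, v, b` form a square matrix `Q`, and `det (Q Qᵀ) = (det Q)²` while the blocks give
`-det T`, where `T` is the type matrix. So `-1` is a square when `det T = 1`, and `-γ` is a square
when `det T = γ`. -/
theorem typeMatrix_eq_of_gram {F : Type*} [Field F] [Fintype F] [DecidableEq F] {γ : F}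
    (hγ : ¬ IsSquare γ) {n m : ℕ} (hn : n = 2 + m) {u v : Fin n → F} {b : Fin m → Fin n → F}
    {δ : ℤ} (hδ : δ = 1 ∨ δ = -1) (huu : u ⬝ᵥ u = 0) (huv : u ⬝ᵥ v = 1) (hvv : v ⬝ᵥ v = 0)
    (hub : ∀ i, u ⬝ᵥ b i = 0) (hvb : ∀ i, v ⬝ᵥ b i = 0)
    (hb : ∀ i j, b i ⬝ᵥ b j = typeMatrix γ δ m i j) :
    typeMatrix γ δ m = typeMatrix γ (quadraticChar F (-1)) m := by
  -- In size 0 the determinant cannot detect the type, but both type matrices are empty.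
  rcases m with _ | m
  · exact Subsingleton.elim _ _
  subst hn
  let Q : Matrix (Fin 2 ⊕ Fin (m + 1)) (Fin (2 + (m + 1))) F :=
    Matrix.of (Sum.elim ![u, v] b)
  let e : Fin (2 + (m + 1)) ≃ Fin 2 ⊕ Fin (m + 1) := finSumFinEquiv.symm
  have hQ : Q * Qᵀ = Matrix.fromBlocks !![0, 1; 1, 0] 0 0 (typeMatrix γ δ (m + 1)) := by
    ext i j
    change Sum.elim ![u, v] b i ⬝ᵥ Sum.elim ![u, v] b j = _
    rcases i with i | i <;> rcases j with j | j
    · fin_cases i <;> fin_cases j <;> simp [huu, huv, hvv, dotProduct_comm v u]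
    · fin_cases i <;> simp [hub, hvb]
    · fin_cases j <;> simp [hub, hvb, dotProduct_comm (b i)]
    · simp [hb]
  have hdet : (Q.submatrix e id).det * (Q.submatrix e id).det =
      -(typeMatrix γ δ (m + 1)).det := by
    have : (Q.submatrix e id) * (Q.submatrix e id)ᵀ = (Q * Qᵀ).submatrix e e := by
      ext i j
      rfl
    have h := congrArg Matrix.det this
    rw [Matrix.det_mul, Matrix.det_transpose, Matrix.det_submatrix_equiv_self, hQ,
      Matrix.det_fromBlocks_zero₂₁, Matrix.det_fin_two_of] at h
    rw [h]
    ring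
  have hneg : (-1 : F) ≠ 0 := neg_ne_zero.2 one_ne_zero
  congr 1
  rcases hδ with rfl | rfl
  · rw [det_typeMatrix_one] at hdet
    exact ((quadraticChar_one_iff_isSquare hneg).2 ⟨_, hdet.symm⟩).symm
  · rw [det_typeMatrix_neg_one] at hdet
    have hγ0 : γ ≠ 0 := by
      rintro rfl
      simp at hγ
    have h := (quadraticChar_one_iff_isSquare (neg_ne_zero.2 hγ0)).2 ⟨_, hdet.symm⟩
    rw [neg_eq_neg_one_mul, map_mul, quadraticChar_neg_one_iff_not_isSquare.2 hγ] at h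
    linarith

/-- The orthogonal complement of a hyperbolic plane in `F ^ n` is isometric to `F ^ (n - 2)`
with the form given by `typeMatrix`. -/
theorem exists_hyperbolic_decomposition {F : Type*} [Field F] [Fintype F] [DecidableEq F]
    (hF : Fintype.card F % 2 = 1) (h2 : (2 : F) ≠ 0) {γ : F} (hγ : ¬ IsSquare γ) {n : ℕ}
    (hn : 2 ≤ n) {u v : Fin n → F} (huu : u ⬝ᵥ u = 0) (huv : u ⬝ᵥ v = 1) (hvv : v ⬝ᵥ v = 0) :
    ∃ b : Fin (n - 2) → Fin n → F, (∀ i, u ⬝ᵥ b i = 0) ∧ (∀ i, v ⬝ᵥ b i = 0) ∧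
      (∀ i j, b i ⬝ᵥ b j = typeMatrix γ (quadraticChar F (-1)) (n - 2) i j) ∧
      ∀ x, u ⬝ᵥ x = 0 → v ⬝ᵥ x = 0 → x ∈ Submodule.span F (Set.range b) := by
  let B : LinearMap.BilinForm F (Fin n → F) := dotProductBilin F F
  have hBapp : ∀ x y, B x y = x ⬝ᵥ y := fun x y => rfl
  have hBs : B.IsSymm := ⟨fun x y => dotProduct_comm x y⟩
  have hBn : B.Nondegenerate :=
    ⟨fun x hx => dotProduct_eq_zero x hx,
      fun x hx => dotProduct_eq_zero x fun w => (dotProduct_comm x w).trans (hx w)⟩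
  have hvu : v ⬝ᵥ u = 1 := by rw [dotProduct_comm, huv]
  have hli : LinearIndependent F ![u, v] := by
    rw [LinearIndependent.pair_iff]
    intro s t hst
    constructor
    · have := congrArg (fun x => v ⬝ᵥ x) hst
      simpa [hvu, hvv] using this
    · have := congrArg (fun x => u ⬝ᵥ x) hst
      simpa [huu, huv] using this
  let W := B.orthogonal (Submodule.span F (Set.range ![u, v]))
  have hW : ∀ x, x ∈ W ↔ u ⬝ᵥ x = 0 ∧ v ⬝ᵥ x = 0 := by
    intro x
    constructor
    · intro hx
      exact ⟨hx u (Submodule.subset_span ⟨0, rfl⟩), hx v (Submodule.subset_span ⟨1, rfl⟩)⟩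
    · rintro ⟨hux, hvx⟩ y hy
      obtain ⟨c, rfl⟩ := (Submodule.mem_span_range_iff_exists_fun F).1 hy
      change B _ x = 0
      rw [hBapp]
      simp [Fin.sum_univ_two, add_dotProduct, hux, hvx]
  have hfr : Module.finrank F W = n - 2 := by
    rw [LinearMap.BilinForm.finrank_orthogonal hBn, finrank_span_eq_card hli]
    simp
  have hWn : (B.restrict W).Nondegenerate := by
    have key : ∀ x : W, (∀ y : W, (x : Fin n → F) ⬝ᵥ (y : Fin n → F) = 0) → x = 0 := by
      rintro ⟨x, hx⟩ h
      obtain ⟨hux, hvx⟩ := (hW x).1 hx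
      refine Subtype.ext (dotProduct_eq_zero x fun z => ?_)
      -- Removing from `z` its part in the hyperbolic plane lands in `W` without changing its
      -- pairing with `x`.
      have := h ⟨z - (v ⬝ᵥ z) • u - (u ⬝ᵥ z) • v, (hW _).2
        ⟨by simp [huu, huv], by simp [hvu, hvv]⟩⟩
      simpa [dotProduct_comm x u, dotProduct_comm x v, hux, hvx] using this
    exact ⟨fun x hx => key x hx, fun x hx => key x fun y => (dotProduct_comm _ _).trans (hx y)⟩
  obtain ⟨δ, hδ, b, hb⟩ := exists_gram_eq_typeMatrix hF h2 hγ (hBs.restrict W) hWn hfr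
  have hb' : ∀ i j, (b i : Fin n → F) ⬝ᵥ (b j : Fin n → F) = typeMatrix γ δ (n - 2) i j := hb
  have hub := fun i => ((hW _).1 (b i).2).1
  have hvb := fun i => ((hW _).1 (b i).2).2
  refine ⟨fun i => b i, hub, hvb, ?_, ?_⟩
  · rw [← typeMatrix_eq_of_gram hγ (by omega) hδ huu huv hvv hub hvb hb']
    exact hb'
  · intro x hux hvx
    have hbl : LinearIndependent F b := by
      refine LinearMap.linearIndependent_of_isOrthoᵢ (B := B.restrict W) ?_ ?_
      · intro i j hij
        exact (hb i j).trans (Matrix.diagonal_apply_ne _ hij)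
      · intro i
        rw [hb]
        exact typeMatrix_apply_self_ne_zero hγ δ _ i
    have hspan := hbl.span_eq_top_of_card_eq_finrank' (by rw [hfr, Fintype.card_fin])
    have hx : (⟨x, (hW x).2 ⟨hux, hvx⟩⟩ : W) ∈ Submodule.span F (Set.range b) := by
      rw [hspan]
      trivial
    have := Submodule.mem_map_of_mem (f := W.subtype) hx
    rwa [Submodule.map_span, ← Set.range_comp] at this

/-! ### Codes with a prescribed hull line -/

theorem mem_span_singleton_sup_map {F : Type*} [Field F] {m n : ℕ} {u : Fin n → F}
    {β : (Fin m → F) →ₗ[F] (Fin n → F)} {D : Submodule F (Fin m → F)} {x : Fin n → F} :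
    x ∈ Submodule.span F {u} ⊔ D.map β ↔ ∃ t : F, ∃ d ∈ D, t • u + β d = x := by
  rw [Submodule.mem_sup]
  constructor
  · rintro ⟨_, hy, _, ⟨d, hd, rfl⟩, rfl⟩
    obtain ⟨t, rfl⟩ := Submodule.mem_span_singleton.1 hy
    exact ⟨t, d, hd, rfl⟩
  · rintro ⟨t, d, hd, rfl⟩
    exact ⟨_, Submodule.mem_span_singleton.2 ⟨t, rfl⟩, _, ⟨d, hd, rfl⟩, rfl⟩

/-- Pairing with `v` reads off the coefficient of `u` and kills the image of `β`, so the sum is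
direct. -/
theorem finrank_span_singleton_sup_map {F : Type*} [Field F] {m n : ℕ} {u v : Fin n → F}
    {β : (Fin m → F) →ₗ[F] (Fin n → F)} (huv : v ⬝ᵥ u = 1) (hv : ∀ d, v ⬝ᵥ β d = 0)
    (hβ : Function.Injective β) (D : Submodule F (Fin m → F)) :
    Module.finrank F (Submodule.span F {u} ⊔ D.map β : Submodule F (Fin n → F)) =
      Module.finrank F D + 1 := by
  have hu : u ≠ 0 := by
    rintro rfl
    simp at huv
  have hinf : Submodule.span F {u} ⊓ D.map β = ⊥ := by
    rw [Submodule.eq_bot_iff]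
    rintro _ ⟨hx, d, -, rfl⟩
    obtain ⟨t, ht⟩ := Submodule.mem_span_singleton.1 hx
    have := hv d
    rw [← ht, dotProduct_smul, huv, smul_eq_mul, mul_one] at this
    rw [← ht, this, zero_smul]
  have h := Submodule.finrank_sup_add_finrank_inf_eq (Submodule.span F {u}) (D.map β)
  rw [hinf, finrank_bot, finrank_span_singleton hu,
    ← (Submodule.equivMapOfInjective β hβ D).finrank_eq] at h
  omega

theorem comap_span_singleton_sup_map {F : Type*} [Field F] {m n : ℕ} {u v : Fin n → F}
    {β : (Fin m → F) →ₗ[F] (Fin n → F)} (huv : v ⬝ᵥ u = 1) (hv : ∀ d, v ⬝ᵥ β d = 0)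
    (hβ : Function.Injective β) (D : Submodule F (Fin m → F)) :
    (Submodule.span F {u} ⊔ D.map β).comap β = D := by
  ext d
  rw [Submodule.mem_comap, mem_span_singleton_sup_map]
  constructor
  · rintro ⟨t, d', hd', h⟩
    have ht := congrArg (fun x => v ⬝ᵥ x) h
    simp only [dotProduct_add, dotProduct_smul, huv, hv, smul_eq_mul, mul_one, add_zero] at ht
    rw [ht, zero_smul, zero_add] at h
    rwa [← hβ h]
  · intro hd
    exact ⟨0, d, hd, by simp⟩

/-- As `u` is orthogonal to the whole sum, the hull is `⟨u⟩` plus the image of the `T`-hull of `D`.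
-/
theorem hull_span_singleton_sup_map {F : Type*} [Field F] {m n : ℕ} {u v : Fin n → F}
    {β : (Fin m → F) →ₗ[F] (Fin n → F)} {T : Matrix (Fin m) (Fin m) F} (huu : u ⬝ᵥ u = 0)
    (huv : v ⬝ᵥ u = 1) (hu : ∀ d, u ⬝ᵥ β d = 0) (hv : ∀ d, v ⬝ᵥ β d = 0)
    (hT : ∀ d d', β d ⬝ᵥ β d' = d ⬝ᵥ T *ᵥ d')
    (hβ : Function.Injective β) (D : Submodule F (Fin m → F)) :
    hull 1 (Submodule.span F {u} ⊔ D.map β) = Submodule.span F {u} ↔ IsLCD T D := by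
  rw [isLCD_iff]
  constructor
  · intro h y hy hyx
    have hmem : β y ∈ hull 1 (Submodule.span F {u} ⊔ D.map β) := by
      refine mem_hull_one_iff.2 ⟨mem_span_singleton_sup_map.2 ⟨0, y, hy, by simp⟩, ?_⟩
      intro x hx
      obtain ⟨t, d, hd, rfl⟩ := mem_span_singleton_sup_map.1 hx
      rw [add_dotProduct, smul_dotProduct, hu, hT, hyx d hd, smul_zero, add_zero]
    rw [h, Submodule.mem_span_singleton] at hmem
    obtain ⟨s, hs⟩ := hmem
    have h0 := hv y
    rw [← hs, dotProduct_smul, huv, smul_eq_mul, mul_one] at h0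
    rw [h0, zero_smul] at hs
    exact hβ (by rw [← hs, map_zero])
  · intro h
    apply le_antisymm
    · intro y hy
      rw [mem_hull_one_iff] at hy
      obtain ⟨t, d, hd, rfl⟩ := mem_span_singleton_sup_map.1 hy.1
      have hd0 := h d hd fun x hx => by
        have := hy.2 (β x) (mem_span_singleton_sup_map.2 ⟨0, x, hx, by simp⟩)
        rwa [dotProduct_add, dotProduct_smul, dotProduct_comm, hu, hT, smul_zero,
          zero_add] at this
      rw [hd0, map_zero, add_zero]
      exact Submodule.mem_span_singleton.2 ⟨t, rfl⟩
    · rw [Submodule.span_singleton_le_iff_mem, mem_hull_one_iff]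
      refine ⟨mem_span_singleton_sup_map.2 ⟨1, 0, D.zero_mem, by simp⟩, fun x hx => ?_⟩
      obtain ⟨t, d, hd, rfl⟩ := mem_span_singleton_sup_map.1 hx
      rw [add_dotProduct, smul_dotProduct, huu, dotProduct_comm, hu, smul_zero, add_zero]

/-- The number of `k`-dimensional codes whose hull is the line spanned by a given isotropic
vector. -/
theorem ncard_hull_eq_span_singleton {F : Type*} [Field F] [Fintype F] [DecidableEq F]
    (hF : Fintype.card F % 2 = 1) (h2 : (2 : F) ≠ 0) {γ : F} (hγ : ¬ IsSquare γ) {n k : ℕ}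
    (hn : 2 ≤ n) (hk : 1 ≤ k) {u : Fin n → F} (hu0 : u ≠ 0) (huu : u ⬝ᵥ u = 0) :
    Set.ncard {C : Submodule F (Fin n → F) |
      Module.finrank F C = k ∧ hull 1 C = Submodule.span F {u}} =
      lcdCountType γ (quadraticChar F (-1)) (n - 2) (k - 1) := by
  obtain ⟨v, huv, hvv⟩ := exists_hyperbolic_partner h2 hu0 huu
  obtain ⟨b, hub, hvb, hb, hspan⟩ := exists_hyperbolic_decomposition hF h2 hγ hn huu huv hvv
  have hvu : v ⬝ᵥ u = 1 := by rw [dotProduct_comm, huv]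
  rw [lcdCountType, lcdCountFor]
  set T := typeMatrix γ (quadraticChar F (-1)) (n - 2) with hTdef
  let β : (Fin (n - 2) → F) →ₗ[F] (Fin n → F) := (Matrix.of b).vecMulLinear
  have hrange : LinearMap.range β = Submodule.span F (Set.range b) := range_vecMulLinear _
  have hort : ∀ w : Fin n → F, (∀ i, w ⬝ᵥ b i = 0) → ∀ d, w ⬝ᵥ β d = 0 := by
    intro w hw d
    change w ⬝ᵥ d ᵥ* Matrix.of b = 0
    have : Matrix.of b *ᵥ w = 0 := by
      ext i
      exact (dotProduct_comm _ _).trans (hw i)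
    rw [dotProduct_comm, ← Matrix.dotProduct_mulVec, this, dotProduct_zero]
  have hu := hort u hub
  have hv := hort v hvb
  have hT : ∀ d d', β d ⬝ᵥ β d' = d ⬝ᵥ T *ᵥ d' := by
    intro d d'
    have h := dotProduct_mulVec_vecMul (Matrix.of b) 1 d d'
    rw [Matrix.one_mulVec, Matrix.mul_one] at h
    refine h.trans ?_
    congr 2
    ext i j
    exact hb i j
  -- The map `β` carries the form of the invertible matrix `T`, so its kernel lies in a zero
  -- radical.
  have hβ : Function.Injective β := by
    rw [← LinearMap.ker_eq_bot, LinearMap.ker_eq_bot']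
    intro d hd
    have hdet : T.det ≠ 0 := by
      rw [hTdef, typeMatrix, Matrix.det_diagonal, Finset.prod_ne_zero_iff]
      intro i _
      have := typeMatrix_apply_self_ne_zero hγ (quadraticChar F (-1)) (n - 2) i
      rwa [typeMatrix, Matrix.diagonal_apply_eq] at this
    refine Matrix.eq_zero_of_mulVec_eq_zero hdet (dotProduct_eq_zero _ fun w => ?_)
    rw [dotProduct_comm, ← hT, hd, dotProduct_zero]
  have hset : {C : Submodule F (Fin n → F) |
      Module.finrank F C = k ∧ hull 1 C = Submodule.span F {u}} =
      (fun D : Submodule F (Fin (n - 2) → F) => Submodule.span F {u} ⊔ D.map β) ''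
        {D | Module.finrank F D = k - 1 ∧ IsLCD T D} := by
    ext C
    constructor
    · rintro ⟨hCk, hC⟩
      have huC : u ∈ hull 1 C := by
        rw [hC]
        exact Submodule.mem_span_singleton_self u
      rw [mem_hull_one_iff] at huC
      -- Since `u` is in the hull, `C` lies in `u^⊥`; hence `x - (v·x) u` lies in `{u,v}^⊥`, the
      -- range of `β`, and also in `C`.
      have hCe : Submodule.span F {u} ⊔ (C.comap β).map β = C := by
        ext x
        rw [mem_span_singleton_sup_map]
        constructor
        · rintro ⟨t, d, hd, rfl⟩
          exact C.add_mem (C.smul_mem t huC.1) hd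
        · intro hx
          have hxu : u ⬝ᵥ x = 0 := by rw [dotProduct_comm, huC.2 x hx]
          have hmem : x - (v ⬝ᵥ x) • u ∈ LinearMap.range β := by
            rw [hrange]
            exact hspan _ (by simp [hxu, huu]) (by simp [hvu])
          obtain ⟨d, hd⟩ := hmem
          refine ⟨v ⬝ᵥ x, d, ?_, by rw [hd]; abel⟩
          rw [Submodule.mem_comap, hd]
          exact C.sub_mem hx (C.smul_mem _ huC.1)
      refine ⟨C.comap β, ⟨?_, ?_⟩, hCe⟩
      · have := finrank_span_singleton_sup_map hvu hv hβ (C.comap β)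
        rw [hCe] at this
        omega
      · rw [← hull_span_singleton_sup_map huu hvu hu hv hT hβ, hCe, hC]
    · rintro ⟨D, ⟨hDk, hD⟩, rfl⟩
      refine ⟨?_, (hull_span_singleton_sup_map huu hvu hu hv hT hβ D).2 hD⟩
      rw [finrank_span_singleton_sup_map hvu hv hβ, hDk]
      omega
  rw [hset]
  refine Set.ncard_image_of_injective _ fun D D' h => ?_
  rw [← comap_span_singleton_sup_map hvu hv hβ D, ← comap_span_singleton_sup_map hvu hv hβ D']
  exact congrArg (Submodule.comap β) h

/-! ### Double counting -/

theorem self_dotProduct_eq_zero_of_hull_eq {F : Type*} [Field F] {n : ℕ}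
    {C : Submodule F (Fin n → F)} {u : Fin n → F} (h : hull 1 C = Submodule.span F {u}) :
    u ⬝ᵥ u = 0 := by
  have hu : u ∈ hull 1 C := by
    rw [h]
    exact Submodule.mem_span_singleton_self u
  rw [mem_hull_one_iff] at hu
  exact hu.2 u hu.1

theorem sum_ne_zero_ne_zero {F : Type*} [Field F] {n : ℕ} {u : Fin n → F}
    (h : ∑ i, u i ≠ 0) : u ≠ 0 := by
  rintro rfl
  simp at h

theorem ncard_generators_of_hull {F : Type*} [Field F] [Fintype F] [DecidableEq F] {n : ℕ}
    {C : Submodule F (Fin n → F)} {u : Fin n → F} (hs : ∑ i, u i ≠ 0)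
    (h : hull 1 C = Submodule.span F {u}) :
    Set.ncard {w : Fin n → F | ∑ i, w i ≠ 0 ∧ hull 1 C = Submodule.span F {w}} =
      Fintype.card F - 1 := by
  have hset : {w : Fin n → F | ∑ i, w i ≠ 0 ∧ hull 1 C = Submodule.span F {w}} =
      (fun c : F => c • u) '' {0}ᶜ := by
    ext w
    constructor
    · rintro ⟨hw, hC⟩
      have : w ∈ Submodule.span F {u} := by
        rw [← h, hC]
        exact Submodule.mem_span_singleton_self w
      obtain ⟨c, rfl⟩ := Submodule.mem_span_singleton.1 this
      refine ⟨c, ?_, rfl⟩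
      rintro rfl
      simp at hw
    · rintro ⟨c, hc, rfl⟩
      have hc : c ≠ 0 := hc
      refine ⟨?_, ?_⟩
      · simp only [Pi.smul_apply, smul_eq_mul, ← Finset.mul_sum]
        exact mul_ne_zero hc hs
      · rw [h]
        exact (Submodule.span_singleton_smul_eq (IsUnit.mk0 c hc) u).symm
  rw [hset, Set.ncard_image_of_injective _ (smul_left_injective F (sum_ne_zero_ne_zero hs)),
    Set.ncard_compl, Set.ncard_singleton, Nat.card_eq_fintype_card]

/-- Pairs `(u, C)` with `⟨u⟩` the hull of `C` are counted by `u` on the left and by `C` on the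
right. -/
theorem isotropicCount_mul_lcdCountType {F : Type*} [Field F] [Fintype F] [DecidableEq F]
    (hF : Fintype.card F % 2 = 1) (h2 : (2 : F) ≠ 0) {γ : F} (hγ : ¬ IsSquare γ) {n k : ℕ}
    (hn : 2 ≤ n) (hk : 1 ≤ k) :
    isotropicCount F n * lcdCountType γ (quadraticChar F (-1)) (n - 2) (k - 1) =
      Set.ncard {C : Submodule F (Fin n → F) | Module.finrank F C = k ∧
        ∃ u, ∑ i, u i ≠ 0 ∧ hull 1 C = Submodule.span F {u}} * (Fintype.card F - 1) := by
  classical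
  have : Fintype (Submodule F (Fin n → F)) := Fintype.ofFinite _
  rw [isotropicCount, Set.ncard_eq_toFinset_card', Set.ncard_eq_toFinset_card']
  refine Finset.card_mul_eq_card_mul (fun u C => hull 1 C = Submodule.span F {u}) ?_ ?_
  · intro u hu
    rw [Set.mem_toFinset] at hu
    rw [← ncard_hull_eq_span_singleton hF h2 hγ hn hk (sum_ne_zero_ne_zero hu.2) hu.1,
      Set.ncard_eq_toFinset_card']
    congr 1
    ext C
    simp only [Finset.mem_bipartiteAbove, Set.mem_toFinset, Set.mem_ofPred_eq]
    exact ⟨fun h => ⟨h.1.1, h.2⟩, fun h => ⟨⟨h.1, u, hu.2, h.2⟩, h.2⟩⟩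
  · intro C hC
    rw [Set.mem_toFinset] at hC
    obtain ⟨-, u, hs, h⟩ := hC
    rw [← ncard_generators_of_hull hs h, Set.ncard_eq_toFinset_card']
    congr 1
    ext w
    simp only [Finset.mem_bipartiteBelow, Set.mem_toFinset, Set.mem_ofPred_eq]
    exact ⟨fun h => ⟨h.1.2, h.2⟩,
      fun h => ⟨⟨self_dotProduct_eq_zero_of_hull_eq h.2, h.1⟩, h.2⟩⟩

theorem giReducibleCount_eq {F : Type*} [Field F] [Fintype F] (h2 : (2 : F) ≠ 0) {n k : ℕ}
    (hn : 2 ≤ n) :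
    giReducibleCount F n k = lcdCount F n k +
      Set.ncard {C : Submodule F (Fin n → F) | Module.finrank F C = k ∧
        ∃ u, ∑ i, u i ≠ 0 ∧ hull 1 C = Submodule.span F {u}} := by
  rw [giReducibleCount, lcdCount, lcdCountFor, ← Set.ncard_union_eq]
  · congr 1
    ext C
    simp only [Set.mem_ofPred_eq, Set.mem_union, isGIReducible_iff_hull h2 hn, and_or_left]
  · rw [Set.disjoint_left]
    rintro C ⟨-, hC⟩ ⟨-, u, hs, hu⟩
    rw [IsLCD, hu, Submodule.span_singleton_eq_bot] at hC
    exact sum_ne_zero_ne_zero hs hC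

end GICode

theorem theorem5p3 {F : Type*} [Field F] [Fintype F] [DecidableEq F]
    (q : ℕ) (hcard : Fintype.card F = q) (hq : Odd q)
    (γ : F) (hγ : ¬ IsSquare γ)
    (n k : ℕ) (hk : 1 ≤ k) (hkn : k < n) :
    (GICode.giReducibleCount F n k : ℚ) =
        (GICode.lcdCount F n k : ℚ) +
          (GICode.isotropicCount F n : ℚ) / ((q : ℚ) - 1) *
            (GICode.lcdCountType γ (quadraticChar F (-1)) (n - 2) (k - 1) : ℚ) ∧
      (q % 4 = 1 → quadraticChar F (-1) = 1) ∧
      (q % 4 = 3 → quadraticChar F (-1) = -1) := by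
  subst hcard
  have hF : Fintype.card F % 2 = 1 := Nat.odd_iff.1 hq
  have hchar : ringChar F ≠ 2 := fun h => by
    have := FiniteField.even_card_of_char_two h
    omega
  have h2 : (2 : F) ≠ 0 := Ring.two_ne_zero hchar
  have hn : 2 ≤ n := by omega
  refine ⟨?_, fun h => ?_, fun h => ?_⟩
  · have hcount := GICode.isotropicCount_mul_lcdCountType hF h2 hγ hn hk
    have hq1 : 1 < Fintype.card F := Fintype.one_lt_card
    have hcount' := congrArg (Nat.cast : ℕ → ℚ) hcount
    rw [Nat.cast_mul, Nat.cast_mul, Nat.cast_sub hq1.le, Nat.cast_one] at hcount'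
    have hne : (Fintype.card F : ℚ) - 1 ≠ 0 := by
      have : (1 : ℚ) < Fintype.card F := by exact_mod_cast hq1
      linarith
    rw [GICode.giReducibleCount_eq h2 hn, Nat.cast_add, add_right_inj, div_mul_eq_mul_div,
      hcount', mul_div_cancel_right₀ _ hne]
  · rw [quadraticChar_neg_one hchar, ZMod.χ₄_nat_one_mod_four h]
  · rw [quadraticChar_neg_one hchar, ZMod.χ₄_nat_three_mod_four h]
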